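/- Rings are associative and need not have a unit. A \emph{profinite ring} (regarded as a profinite structure) is a compact Hausdorff topological ring $R$ with a distinguished countable basis $\mathcal B$ of open neighbourhoods of $0$ consisting of clopen ideals, together with a structural group $\mathrm{Aut}^*(R)$, that is, a closed subgroup of the group of all ring automorphisms of $R$ which fix setwise every ideal in $\mathcal B$. It is \emph{small} if for every $n$ the group $\mathrm{Aut}^*(R)$ has only countably many orbits on $R^n$. For $A\subseteq R$ and $a\in R$ let $o(a/A)$ be the orbit of $a$ under the pointwise stabilizer of $A$ in $\mathrm{Aut}^*(R)$. An element $g\in R$ is \emph{generic} if $o(g/\emptyset)$ is open in $R$. A tuple $(g_1,\dots,g_n)$ is \emph{independent} if for each $i$ the orbit $o(g_i/\{g_1,\dots,g_{i-1}\})$ is open in $o(g_i/\emptyset)$. The ring $R$ is \emph{nilpotent} if for some $m\ge 1$ all products of $m$ elements of $R$ are $0$; it is \emph{nil of nilexponent} $m$ if $x^m=0$ for all $x\in R$ and $m$ is the least positive integer with this property. Write $\mathrm{ann}(a)=\{x\in R: xa=ax=0\}$. \textbf{Proposition.} Let $p$ be a prime number and let $R$ be a non-nilpotent, commutative, small profinite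 ring of characteristic $p$ which is nil of nilexponent $p$. (1) For every generic $g\in R$ and every $j\in\{1,\dots,p-1\}$ we have $g^j\neq 0$. (2) Assume additionally that $R/\mathrm{ann}(a)$ is non-nilpotent for every $a\in R\setminus\{0\}$. Then for every $n$, every polynomial $f\in\mathbb F_p[x_1,\dots,x_n]\setminus\{0\}$ with $\deg_{x_1}(f),\dots,\deg_{x_n}(f)<p$, and every independent tuple $(g_1,\dots,g_n)$ of generics of $R$, we have $f(g_1,\dots,g_n)\neq 0$, where the value is computed in the ring $\mathbb F_p\oplus R$ obtained from $R$ by adjoining a unit (it lies in $R$ when $f$ has zero constant term). -/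

import Mathlib

/-! ### Rings without unit -/

/-- The power `x ^ n` of an element of a ring that need not have a unit vanishes. The power is
computed in the ring `ℤ ⊕ R` obtained by adjoining a unit, so that `x ^ 0 = 1` is never zero and
`x ^ n` for `1 ≤ n` is the usual power in `R`. -/
def PowEqZero {R : Type*} [NonUnitalRing R] (x : R) (n : ℕ) : Prop :=
  (x : Unitization ℤ R) ^ n = 0

/-- `x` is nilpotent of nilexponent `n`. -/
def HasNilexponent {R : Type*} [NonUnitalRing R] (x : R) (n : ℕ) : Prop :=
  IsLeast {m : ℕ | PowEqZero x m} n

/-- `R` is nil of nilexponent `n`: every element is nilpotent of nilexponent at most `n`, and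
some element has nilexponent exactly `n`. -/
def IsNilOfNilexponent (R : Type*) [NonUnitalRing R] (n : ℕ) : Prop :=
  (∀ x : R, ∃ m ≤ n, HasNilexponent x m) ∧ ∃ x : R, HasNilexponent x n

/-- `R` is nilpotent: for some `n`, all products `r₁ ⋯ rₙ` of `n` elements of `R` are zero.
(Products are computed in `ℤ ⊕ R`; `n = 0` is impossible because the empty product is `1`.) -/
def IsNilpotentRing (R : Type*) [NonUnitalRing R] : Prop :=
  ∃ n : ℕ, ∀ l : List R, l.length = n →
    (l.map (fun r => (r : Unitization ℤ R))).prod = 0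

/-- The characteristic of `R` is the positive number `n`: it is the least positive integer that
annihilates the additive group of `R`. -/
def HasCharacteristic (R : Type*) [NonUnitalRing R] (n : ℕ) : Prop :=
  IsLeast {m : ℕ | 0 < m ∧ ∀ x : R, m • x = 0} n

/-- The annihilator of `a`, an ideal of the commutative ring `R`. -/
def annIdeal {R : Type*} [NonUnitalCommRing R] (a : R) : TwoSidedIdeal R :=
  TwoSidedIdeal.mk' {x : R | x * a = 0 ∧ a * x = 0}
    (by simp)
    (by rintro x y ⟨h₁, h₂⟩ ⟨h₃, h₄⟩; exact ⟨by simp [add_mul, h₁, h₃], by simp [mul_add, h₂, h₄]⟩)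
    (by rintro x ⟨h₁, h₂⟩; exact ⟨by simp [h₁], by simp [h₂]⟩)
    (by
      rintro x y ⟨h₁, h₂⟩
      exact ⟨by rw [mul_assoc, h₁, mul_zero], by rw [mul_left_comm, h₂, mul_zero]⟩)
    (by
      rintro x y ⟨h₁, h₂⟩
      exact ⟨by rw [mul_right_comm, h₁, zero_mul], by rw [← mul_assoc, h₂, zero_mul]⟩)

/-- The quotient ring `R / ann(a)`. -/
abbrev AnnQuotient {R : Type*} [NonUnitalCommRing R] (a : R) : Type _ :=
  (annIdeal a).ringCon.Quotient

/-- The value `f(g₁, …, gₙ)` of a polynomial over `𝔽_p` at a tuple of elements of a commutative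
ring `R` of characteristic `p` without unit. Because `f` may have a constant term, the value is
taken in the `𝔽_p`-algebra `𝔽_p ⊕ R` obtained by adjoining a unit; it lies in `R` when the constant
term is zero. -/
noncomputable def polyValue {R : Type*} [NonUnitalCommRing R] {p : ℕ}
    (hR : HasCharacteristic R p) {n : ℕ} (f : MvPolynomial (Fin n) (ZMod p)) (g : Fin n → R) :
    Unitization (ZMod p) R :=
  letI : Module (ZMod p) R := AddCommGroup.zmodModule hR.1.2
  haveI : IsScalarTower (ZMod p) R R :=
    ⟨fun c x y => ZMod.map_smul (AddMonoidHom.mulRight y) c x⟩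
  haveI : SMulCommClass (ZMod p) R R :=
    ⟨fun c x y => (ZMod.map_smul (AddMonoidHom.mulLeft x) c y).symm⟩
  MvPolynomial.aeval (fun i => (g i : Unitization (ZMod p) R)) f

/-! ### Profinite rings regarded as profinite structures -/

/-- The standard structural group: all ring automorphisms of `R` that fix setwise each ideal in
the given family. -/
def standardStructuralGroup {R : Type*} [NonUnitalRing R] (basis : Set (TwoSidedIdeal R)) :
    Subgroup (RingAut R) where
  carrier := {σ | ∀ I ∈ basis, ∀ x : R, σ x ∈ I ↔ x ∈ I}
  one_mem' := fun _ _ _ => Iff.rfl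
  mul_mem' := fun {σ τ} hσ hτ I hI x => (hσ I hI (τ x)).trans (hτ I hI x)
  inv_mem' := fun {σ} hσ I hI x => by
    have h := hσ I hI (σ⁻¹ x)
    have e : σ (σ⁻¹ x) = x := σ.apply_symm_apply x
    rw [e] at h
    exact h.symm

/-- The structure of a profinite ring on a topological ring `R` (which is to be compact and
Hausdorff): a distinguished countable basis of neighbourhoods of `0` consisting of (automatically
clopen) ideals, together with the structural group, a subgroup of the standard structural group
that is closed in it for the topology of pointwise convergence (which on the standard structural
group is the inverse limit topology). -/
structure ProfiniteRingStructure (R : Type*) [NonUnitalRing R] [TopologicalSpace R] where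
  basis : Set (TwoSidedIdeal R)
  countable_basis : basis.Countable
  hasBasis : (nhds (0 : R)).HasBasis (fun I => I ∈ basis) (fun I => (I : Set R))
  group : Subgroup (RingAut R)
  group_le : group ≤ standardStructuralGroup basis
  group_closed : ∃ C : Set (R → R), IsClosed C ∧
    ∀ σ ∈ standardStructuralGroup basis, σ ∈ group ↔ (fun x => σ x) ∈ C

namespace ProfiniteRingStructure

variable {R : Type*} [NonUnitalRing R] [TopologicalSpace R] (S : ProfiniteRingStructure R)

/-- The orbit over `∅` of an `n`-tuple under the structural group. -/
def tupleOrbit {n : ℕ} (a : Fin n → R) : Set (Fin n → R) :=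
  {b | ∃ σ ∈ S.group, ∀ i, b i = σ (a i)}

/-- Smallness: for every `n` there are only countably many orbits on `n`-tuples. -/
def IsSmall : Prop :=
  ∀ n : ℕ, (Set.range (fun a : Fin n → R => S.tupleOrbit a)).Countable

/-- The orbit `o(a/A)` of `a` under the pointwise stabilizer of `A` in the structural group. -/
def orbitOver (A : Set R) (a : R) : Set R :=
  {b | ∃ σ ∈ S.group, (∀ x ∈ A, σ x = x) ∧ b = σ a}

/-- `g` is generic (over `∅`): its orbit is open in `R`. -/
def IsGeneric (g : R) : Prop := IsOpen (S.orbitOver ∅ g)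

/-- `a` is `m`-independent from `B` over `A`: the orbit `o(a/AB)` is open in `o(a/A)`. -/
def MIndependent (A : Set R) (a : R) (B : Set R) : Prop :=
  ∃ U : Set R, IsOpen U ∧ S.orbitOver (A ∪ B) a = U ∩ S.orbitOver A a

/-- The tuple `(g₁, …, gₙ)` is independent (over `∅`): each `gᵢ` is `m`-independent from its
predecessors. (This is implied by each `gᵢ` being `m`-independent from all the other entries, and
in small structures the two conditions are equivalent.) -/
def IndependentTuple {n : ℕ} (g : Fin n → R) : Prop :=
  ∀ i : Fin n, S.MIndependent ∅ (g i) (g '' {j | j < i})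

end ProfiniteRingStructure

/-!
Let `M` be the copy of `R` in `A = 𝔽_p ⊕ R`, and let `P` be a polynomial of degree `D < p` over `A`
that vanishes on a nonempty open subset of `R`, hence on a coset of an open subgroup `H`. Polarizing
`P`, that is, taking `D` finite differences in directions of `H`, yields `D !` times the leading
coefficient times the product of the directions; as `D !` is invertible, the leading coefficient
annihilates `(A H) ^ D`. Since `R` is compact, `H` has finite index, and since `R` is nil, some
power of `M` is contained in `A H`. So the leading coefficient of `P` annihilates a power of `M`. If
`R` is not nilpotent, `P` cannot be monic; if moreover no `R / ann(a)` with `a ≠ 0` is nilpotent,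
`P` must be zero.

If the pointwise stabilizer of a set `B` fixes the coefficients of `P` and `P` has a root `g`, then
`P` vanishes on the orbit `o(g/B)`. For a generic `g` this applies to `X ^ j` with `B = ∅`. For an
independent tuple of generics it shows that each entry satisfies no nonzero polynomial of degree
less than `p` over its predecessors, and the variables of `f` are eliminated one at a time.
-/

section Polynomial

variable {A : Type*} [CommRing A]

open Polynomial

theorem natDegree_taylor_sub_self_le {P : A[X]} {D : ℕ} (hP : P.natDegree ≤ D + 1) (h : A) :
    (taylor h P - P).natDegree ≤ D := by
  rw [natDegree_le_iff_coeff_eq_zero]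
  intro N hN
  obtain rfl | hN := (Nat.succ_le_of_lt hN).eq_or_lt
  · have hderiv := natDegree_hasseDeriv_le P (D + 1)
    rw [coeff_sub, taylor_coeff, eq_C_of_natDegree_le_zero (hderiv.trans (by lia)), eval_C,
      hasseDeriv_coeff]
    simp
  · rw [coeff_sub, coeff_eq_zero_of_natDegree_lt (by rw [natDegree_taylor]; lia),
      coeff_eq_zero_of_natDegree_lt (by lia), sub_zero]

theorem coeff_taylor_sub_self {P : A[X]} {D : ℕ} (hP : P.natDegree ≤ D + 1) (h : A) :
    (taylor h P - P).coeff D = (D + 1) * P.coeff (D + 1) * h := by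
  have hderiv := natDegree_hasseDeriv_le P D
  rw [coeff_sub, taylor_coeff,
    eq_X_add_C_of_natDegree_le_one (p := hasseDeriv D P) (hderiv.trans (by lia)),
    hasseDeriv_coeff, hasseDeriv_coeff, add_comm 1 D]
  simp

open Nat in
theorem factorial_mul_coeff_mul_eq_zero (H : AddSubgroup A) (b : A) {D : ℕ} {P : A[X]}
    (hP : P.natDegree ≤ D) (hzero : ∀ h ∈ H, P.eval (b + h) = 0) {x : A}
    (hx : x ∈ Ideal.span (H : Set A) ^ D) : D ! * P.coeff D * x = 0 := by
  induction D generalizing P x with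
  | zero =>
    have hb := hzero 0 H.zero_mem
    rw [eq_C_of_natDegree_le_zero hP, eval_C] at hb
    rw [hb, mul_zero, zero_mul]
  | succ D ih =>
    have hmul : ∀ y ∈ Ideal.span (H : Set A) ^ D, ∀ h ∈ H,
        (D + 1)! * P.coeff (D + 1) * (y * h) = 0 := by
      intro y hy h hh
      have hdiff := ih (natDegree_taylor_sub_self_le hP h) (fun k hk => by
        rw [eval_sub, taylor_eval, add_assoc, hzero _ hk, hzero _ (H.add_mem hk hh), sub_zero]) hy
      rw [coeff_taylor_sub_self hP] at hdiff
      rw [← hdiff, factorial_succ]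
      push_cast
      ring
    suffices hle : Ideal.span (H : Set A) ^ (D + 1) ≤
        LinearMap.ker (LinearMap.mulLeft A ((D + 1)! * P.coeff (D + 1))) from hle hx
    rw [pow_succ, Submodule.mul_le]
    intro y hy h hh
    induction hh using Submodule.span_induction with
    | mem h hh => exact hmul y hy h hh
    | zero => simp
    | add h k _ _ ihh ihk => rw [mul_add]; exact add_mem ihh ihk
    | smul a h _ ihh => rw [smul_eq_mul, mul_left_comm]; exact Ideal.mul_mem_left _ a ihh

end Polynomial

section Nil

variable {A : Type*} [CommRing A]

theorem exists_span_pow_le_of_relIndex_ne_zero {H K : AddSubgroup A} (hHK : H.relIndex K ≠ 0)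
    (hK : ∀ x ∈ K, IsNilpotent x) :
    ∃ N, Ideal.span (K : Set A) ^ N ≤ Ideal.span (H : Set A) := by
  let π := Ideal.Quotient.mk (Ideal.span (H : Set A))
  have hker : H ≤ π.toAddMonoidHom.ker := fun h hh =>
    Ideal.Quotient.eq_zero_iff_mem.2 (Ideal.subset_span hh)
  have hfinite : (π '' K).Finite := by
    have hcard : Nat.card (K.map π.toAddMonoidHom) ≠ 0 := by
      rw [← AddSubgroup.relIndex_ker]
      exact mt (fun h => Nat.eq_zero_of_zero_dvd
        (h ▸ AddSubgroup.relIndex_dvd_of_le_left K hker)) hHK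
    exact (Nat.finite_of_card_ne_zero hcard : Finite (K.map π.toAddMonoidHom))
  have hfg : ((Ideal.span (K : Set A)).map π).FG := by
    rw [Ideal.map_span]
    exact Submodule.fg_span hfinite
  obtain ⟨N, hN⟩ := hfg.isNilpotent_iff_le_nilradical.2 (by
    rw [Ideal.map_span, Ideal.span_le]
    rintro _ ⟨x, hx, rfl⟩
    exact (hK x hx).map π)
  refine ⟨N, ?_⟩
  rwa [← Ideal.map_pow, Ideal.zero_eq_bot, Ideal.map_eq_bot_iff_le_ker, Ideal.mk_ker] at hN

open Polynomial Nat in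
theorem exists_leadingCoeff_mul_span_range_pow_eq_zero {G : Type*} [AddCommGroup G]
    [TopologicalSpace G] [NonarchimedeanAddGroup G] [CompactSpace G] (f : G →+ A)
    (hf : ∀ x, IsNilpotent (f x)) {U : Set G} (hU : IsOpen U) (hne : U.Nonempty) {P : A[X]}
    (hP : IsUnit (P.natDegree ! : A)) (hzero : ∀ y ∈ U, P.eval (f y) = 0) :
    ∃ N, ∀ x ∈ Ideal.span (Set.range f) ^ N, P.leadingCoeff * x = 0 := by
  obtain ⟨b, hb⟩ := hne
  obtain ⟨V, hV⟩ := NonarchimedeanAddGroup.is_nonarchimedean ((b + ·) ⁻¹' U)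
    ((hU.preimage (continuous_const_add b)).mem_nhds (by simpa using hb))
  have hfinite : (V.toAddSubgroup.map f).relIndex f.range ≠ 0 := by
    have := V.toAddSubgroup.finiteIndex_of_finite_quotient
    rw [← AddSubgroup.index_comap]
    exact (AddSubgroup.finiteIndex_of_le (AddSubgroup.le_comap_map f _)).index_ne_zero
  obtain ⟨N, hN⟩ := exists_span_pow_le_of_relIndex_ne_zero hfinite (by
    rintro _ ⟨x, rfl⟩
    exact hf x)
  refine ⟨N * P.natDegree, fun x hx => ?_⟩
  have hmem : x ∈ Ideal.span (V.toAddSubgroup.map f : Set A) ^ P.natDegree :=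
    Ideal.pow_right_mono hN _ (by rwa [← pow_mul])
  rw [← hP.mul_right_eq_zero, ← mul_assoc]
  refine factorial_mul_coeff_mul_eq_zero _ (f b) le_rfl ?_ hmem
  rintro _ ⟨h, hh, rfl⟩
  rw [← map_add]
  exact hzero _ (hV hh)

end Nil

section TranscendentalBelow

variable {k A : Type*} [CommRing k] [CommRing A] [Algebra k A]

/-- The element `y` is transcendental below degree `d` over the subalgebra `B`: it is a root of no
nonzero polynomial of degree less than `d` with coefficients in `B`. The polynomials are taken in
`A[X]`, with a condition on their coefficients. -/
def TranscendentalBelow (B : Subalgebra k A) (d : ℕ) (y : A) : Prop :=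
  ∀ P : Polynomial A, P ≠ 0 → P.natDegree < d → (∀ m, P.coeff m ∈ B) → P.eval y ≠ 0

theorem eval_map_finSuccEquiv {n : ℕ} (g : Fin (n + 1) → A) (f : MvPolynomial (Fin (n + 1)) k) :
    ((MvPolynomial.finSuccEquiv k n f).map
      (MvPolynomial.aeval fun i => g i.succ : MvPolynomial (Fin n) k →ₐ[k] A).toRingHom).eval
        (g 0) = MvPolynomial.aeval g f := by
  induction f using MvPolynomial.induction_on with
  | C a => simp [MvPolynomial.finSuccEquiv_apply]
  | add f₁ f₂ ih₁ ih₂ => simp only [map_add, Polynomial.map_add, Polynomial.eval_add, ih₁, ih₂]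
  | mul_X f i ih =>
    rw [map_mul, map_mul, Polynomial.map_mul, Polynomial.eval_mul, ih]
    congr 1
    induction i using Fin.cases with
    | zero => simp [MvPolynomial.finSuccEquiv_X_zero]
    | succ i => simp [MvPolynomial.finSuccEquiv_X_succ]

theorem aeval_ne_zero_of_transcendentalBelow_Ioi
    (hinj : Function.Injective (algebraMap k A)) {n : ℕ} {d : Fin n → ℕ} {g : Fin n → A}
    (hg : ∀ i, TranscendentalBelow (Algebra.adjoin k (g '' Set.Ioi i)) (d i) (g i))
    {f : MvPolynomial (Fin n) k} (hf : f ≠ 0) (hdeg : ∀ i, f.degreeOf i < d i) :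
    MvPolynomial.aeval g f ≠ 0 := by
  induction n with
  | zero =>
    obtain ⟨c, rfl⟩ := MvPolynomial.C_surjective (Fin 0) f
    rw [MvPolynomial.algHom_C, (map_ne_zero_iff _ hinj)]
    exact (map_ne_zero_iff _ (MvPolynomial.C_injective _ _)).1 hf
  | succ n ih =>
    let tailEval : MvPolynomial (Fin n) k →ₐ[k] A := MvPolynomial.aeval fun i => g i.succ
    let Q := MvPolynomial.finSuccEquiv k n f
    have himage : ∀ i, (fun j : Fin n => g j.succ) '' Set.Ioi i = g '' Set.Ioi i.succ := fun i => by
      rw [← Fin.image_succ_Ioi, Set.image_image]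
    have htail : ∀ q : MvPolynomial (Fin n) k, q ≠ 0 →
        (∀ j : Fin n, q.degreeOf j < d j.succ) → tailEval q ≠ 0 := fun q hq hqdeg =>
      ih (fun i => by rw [himage]; exact hg i.succ) hq hqdeg
    have hQ : Q.map tailEval.toRingHom ≠ 0 := by
      obtain ⟨m, hm⟩ := Polynomial.support_nonempty.2
        ((map_ne_zero_iff _ (MvPolynomial.finSuccEquiv k n).injective).2 hf)
      have hcoeff := htail (Q.coeff m) (Polynomial.mem_support_iff.1 hm)
        fun j => (MvPolynomial.degreeOf_coeff_finSuccEquiv f j m).trans_lt (hdeg _)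
      exact fun hzero => hcoeff (by simpa using congrArg (Polynomial.coeff · m) hzero)
    rw [← eval_map_finSuccEquiv]
    refine hg 0 _ hQ (Polynomial.natDegree_map_le.trans_lt
      ((MvPolynomial.natDegree_finSuccEquiv f).trans_lt (hdeg 0))) fun m => ?_
    have hIoi : g '' Set.Ioi 0 = Set.range fun i : Fin n => g i.succ := by
      rw [Set.range_comp' g Fin.succ, Fin.range_succ]
      congr 1
      ext i
      simp [Fin.pos_iff_ne_zero]
    rw [hIoi, Algebra.adjoin_range_eq_range_aeval, Polynomial.coeff_map]
    exact ⟨_, rfl⟩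

theorem aeval_ne_zero_of_transcendentalBelow
    (hinj : Function.Injective (algebraMap k A)) {n : ℕ} {d : Fin n → ℕ} {g : Fin n → A}
    (hg : ∀ i, TranscendentalBelow (Algebra.adjoin k (g '' Set.Iio i)) (d i) (g i))
    {f : MvPolynomial (Fin n) k} (hf : f ≠ 0) (hdeg : ∀ i, f.degreeOf i < d i) :
    MvPolynomial.aeval g f ≠ 0 := by
  have hrev := aeval_ne_zero_of_transcendentalBelow_Ioi hinj (d := d ∘ Fin.rev) (g := g ∘ Fin.rev)
    (f := MvPolynomial.rename Fin.rev f)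
    (fun i => by
      rw [Set.image_comp, Fin.image_rev, Fin.preimage_rev_Ioi]
      exact hg i.rev)
    ((map_ne_zero_iff _ (MvPolynomial.rename_injective _ Fin.rev_injective)).2 hf)
    (fun i => by
      rw [← Fin.rev_rev i, MvPolynomial.degreeOf_rename_of_injective Fin.rev_injective]
      simpa using hdeg i.rev)
  rwa [MvPolynomial.aeval_rename, Function.comp_assoc, Fin.rev_involutive.comp_self] at hrev

end TranscendentalBelow

section Unitization

theorem PowEqZero.inr_pow_eq_zero {R : Type*} [NonUnitalRing R] (k : Type*) [CommRing k]
    [Module k R] [IsScalarTower k R R] [SMulCommClass k R R] {x : R} {n : ℕ} (h : PowEqZero x n) :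
    (x : Unitization k R) ^ n = 0 := by
  let inrInt : R →ₙₐ[ℤ] Unitization k R :=
    { Unitization.inrNonUnitalAlgHom k R with
      map_smul' := map_zsmul (Unitization.inrNonUnitalAlgHom k R) }
  let extend : Unitization ℤ R →+* Unitization k R := (Unitization.lift inrInt).toRingHom
  have hextend : extend x = (x : Unitization k R) := by
    simp [extend, inrInt]
  rw [← hextend]
  exact (extend.map_pow (x : Unitization ℤ R) n).symm.trans
    ((congrArg extend h).trans extend.map_zero)

variable {k R : Type*} [CommRing k] [NonUnitalCommRing R] [Module k R] [IsScalarTower k R R]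
  [SMulCommClass k R R]

theorem prod_map_inr_cons (x : R) (l : List R) :
    ((x :: l).map ((↑) : R → Unitization k R)).prod =
      ((l.foldl (· * ·) x : R) : Unitization k R) := by
  induction l generalizing x with
  | nil => simp
  | cons y l ih =>
    rw [List.foldl_cons, ← ih (x * y)]
    simp [mul_assoc]

variable (k R) in
/-- The augmentation ideal of `k ⊕ R`, that is, the copy of `R` in it; it is encoded by its
generators, the elements of `R`. -/
def augmentationIdeal : Ideal (Unitization k R) :=
  Ideal.span (Set.range ((↑) : R → Unitization k R))

theorem inr_foldl_mem_augmentationIdeal_pow (x : R) (l : List R) :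
    ((l.foldl (· * ·) x : R) : Unitization k R) ∈ augmentationIdeal k R ^ (l.length + 1) := by
  induction l using List.reverseRecOn with
  | nil => simpa [augmentationIdeal] using Ideal.subset_span (Set.mem_range_self x)
  | append_singleton l y ih =>
    rw [List.foldl_concat, List.length_append, List.length_singleton, pow_succ,
      Unitization.inr_mul]
    exact Ideal.mul_mem_mul ih (Ideal.subset_span (Set.mem_range_self y))

theorem isNilpotentRing_of_surjective_of_augmentationIdeal_pow {R' : Type*}
    [NonUnitalCommRing R'] (π : R →ₙ* R') (hπ : Function.Surjective π) (n : ℕ)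
    (h : ∀ r : R, (r : Unitization k R) ∈ augmentationIdeal k R ^ n → π r = 0) :
    IsNilpotentRing R' := by
  refine ⟨n + 1, fun l hl => ?_⟩
  obtain ⟨l, rfl⟩ := hπ.list_map l
  obtain ⟨x, l, rfl⟩ := List.exists_cons_of_length_eq_add_one (by simpa using hl)
  have hfoldl : (l.map π).foldl (· * ·) (π x) = π (l.foldl (· * ·) x) :=
    List.foldl_map_hom fun a b => (map_mul π a b).symm
  have hlength : l.length = n := by simpa using hl
  have hmem := Ideal.pow_le_pow_right (hlength.ge.trans l.length.le_succ)
    (inr_foldl_mem_augmentationIdeal_pow (k := k) x l)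
  -- In `IsNilpotentRing` the coercion to `ℤ ⊕ R` elaborates to a bind in the list monad.
  rw [List.map_id', List.bind_eq_flatMap]
  refine (congrArg List.prod List.map_eq_flatMap.symm).trans ?_
  rw [List.map_cons, prod_map_inr_cons, hfoldl, h _ hmem, Unitization.inr_zero]

theorem isNilpotentRing_of_augmentationIdeal_pow (n : ℕ)
    (h : ∀ x ∈ augmentationIdeal k R ^ n, x = 0) : IsNilpotentRing R :=
  isNilpotentRing_of_surjective_of_augmentationIdeal_pow (k := k) (.id R) Function.surjective_id n
    fun _ hr => Unitization.inr_injective ((h _ hr).trans (Unitization.inr_zero k).symm)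

theorem isNilpotentRing_annQuotient_of_augmentationIdeal_pow (a : R) (n : ℕ)
    (h : ∀ x ∈ augmentationIdeal k R ^ n, (a : Unitization k R) * x = 0) :
    IsNilpotentRing (AnnQuotient a) := by
  let π : R →ₙ* AnnQuotient a := ⟨(↑), fun _ _ => rfl⟩
  refine isNilpotentRing_of_surjective_of_augmentationIdeal_pow (k := k) π
    Quotient.mk''_surjective n fun r hr => ?_
  have har : a * r = 0 := by
    rw [← Unitization.inr_inj (R := k), Unitization.inr_mul, h _ hr, Unitization.inr_zero]
  have hmem : r ∈ annIdeal a := by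
    rw [annIdeal, TwoSidedIdeal.mem_mk']
    exact ⟨by rw [mul_comm, har], har⟩
  exact (RingCon.eq _).2 hmem

theorem isUnit_of_isUnit_fst (hnil : ∀ x : R, IsNilpotent (x : Unitization k R))
    {c : Unitization k R} (hc : IsUnit c.fst) : IsUnit c := by
  rw [← Unitization.inl_fst_add_inr_snd_eq c]
  exact (hnil _).isUnit_add_left_of_commute (hc.map (Unitization.inlRingHom k R)) (Commute.all _ _)

theorem eq_zero_of_mul_augmentationIdeal_pow_eq_zero {F : Type*} [Field F] [Module F R]
    [IsScalarTower F R R] [SMulCommClass F R R]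
    (hnil : ∀ x : R, IsNilpotent (x : Unitization F R)) (hR : ¬ IsNilpotentRing R)
    (hann : ∀ a : R, a ≠ 0 → ¬ IsNilpotentRing (AnnQuotient a)) {c : Unitization F R} {n : ℕ}
    (h : ∀ x ∈ augmentationIdeal F R ^ n, c * x = 0) : c = 0 := by
  by_cases hfst : c.fst = 0
  · obtain ⟨a, rfl⟩ : ∃ a : R, c = a := ⟨c.snd, by ext <;> simp [hfst]⟩
    by_contra ha
    exact hann a (fun ha0 => ha (by rw [ha0, Unitization.inr_zero]))
      (isNilpotentRing_annQuotient_of_augmentationIdeal_pow a n h)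
  · have hunit : IsUnit c := isUnit_of_isUnit_fst hnil (IsUnit.mk0 _ hfst)
    exact absurd (isNilpotentRing_of_augmentationIdeal_pow n fun x hx =>
      hunit.mul_right_eq_zero.1 (h x hx)) hR

end Unitization

theorem eval_algHom_apply_eq_zero_of_coeff_mem_adjoin {k A : Type*} [CommRing k] [CommRing A]
    [Algebra k A] {B : Set A} {σ : A →ₐ[k] A} (hσ : ∀ x ∈ B, σ x = x) {P : Polynomial A}
    (hP : ∀ m, P.coeff m ∈ Algebra.adjoin k B) {y : A} (hy : P.eval y = 0) :
    P.eval (σ y) = 0 := by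
  have hfix : P.map (σ : A →+* A) = P := by
    ext m
    rw [Polynomial.coeff_map]
    exact AlgHom.adjoin_le_equalizer σ (AlgHom.id k A) hσ (hP m)
  calc P.eval (σ y) = (P.map (σ : A →+* A)).eval (σ y) := by rw [hfix]
    _ = σ (P.eval y) := Polynomial.eval_map_apply ..
    _ = 0 := by rw [hy, map_zero]

namespace ProfiniteRingStructure

section NonUnitalRing

variable {R : Type*} [NonUnitalRing R] [TopologicalSpace R]

theorem nonarchimedeanAddGroup [IsTopologicalRing R] (S : ProfiniteRingStructure R) :
    NonarchimedeanAddGroup R where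
  is_nonarchimedean U hU := by
    obtain ⟨I, hI, hIU⟩ := S.hasBasis.mem_iff.1 hU
    have hopen : IsOpen (AddSubgroup.ofClass I : Set R) :=
      AddSubgroup.isOpen_of_mem_nhds _ (S.hasBasis.mem_of_mem hI)
    exact ⟨⟨AddSubgroup.ofClass I, hopen⟩, hIU⟩

variable (S : ProfiniteRingStructure R)

theorem self_mem_orbitOver (B : Set R) (g : R) : g ∈ S.orbitOver B g :=
  ⟨1, S.group.one_mem, fun _ _ => rfl, rfl⟩

variable {S}

theorem IndependentTuple.isOpen_orbitOver {n : ℕ} {g : Fin n → R} (hind : S.IndependentTuple g)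
    (hgen : ∀ i, S.IsGeneric (g i)) (i : Fin n) :
    IsOpen (S.orbitOver (g '' Set.Iio i) (g i)) := by
  obtain ⟨U, hU, horbit⟩ := hind i
  rw [Set.empty_union] at horbit
  exact horbit ▸ hU.inter (hgen i)

end NonUnitalRing

section NonUnitalCommRing

variable {R : Type*} [NonUnitalCommRing R] [TopologicalSpace R] (S : ProfiniteRingStructure R)
  {p : ℕ} [Module (ZMod p) R] [IsScalarTower (ZMod p) R R] [SMulCommClass (ZMod p) R R]

theorem eval_inr_eq_zero_of_mem_orbitOver {B : Set R} {g b : R} (hb : b ∈ S.orbitOver B g)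
    {P : Polynomial (Unitization (ZMod p) R)}
    (hP : ∀ m, P.coeff m ∈ Algebra.adjoin (ZMod p) ((↑) '' B : Set (Unitization (ZMod p) R)))
    (hg : P.eval (g : Unitization (ZMod p) R) = 0) :
    P.eval (b : Unitization (ZMod p) R) = 0 := by
  obtain ⟨σ, -, hσ, rfl⟩ := hb
  let σₗ : R →ₙₐ[ZMod p] R :=
    { toFun := σ
      map_smul' := ZMod.map_smul σ
      map_zero' := map_zero σ
      map_add' := map_add σ
      map_mul' := map_mul σ }
  let σ₁ : Unitization (ZMod p) R →ₐ[ZMod p] Unitization (ZMod p) R :=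
    Unitization.lift ((Unitization.inrNonUnitalAlgHom (ZMod p) R).comp σₗ)
  have hmap : ∀ x : R, σ₁ x = (σ x : Unitization (ZMod p) R) := fun x => by simp [σ₁, σₗ]
  rw [← hmap]
  refine eval_algHom_apply_eq_zero_of_coeff_mem_adjoin ?_ hP hg
  rintro _ ⟨x, hx, rfl⟩
  rw [hmap, hσ x hx]

variable [IsTopologicalRing R] [CompactSpace R] [Fact p.Prime]

theorem exists_leadingCoeff_mul_eq_zero_of_isOpen_orbitOver
    (hnil : ∀ x : R, IsNilpotent (x : Unitization (ZMod p) R)) {B : Set R} {g : R}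
    (hopen : IsOpen (S.orbitOver B g)) {P : Polynomial (Unitization (ZMod p) R)}
    (hdeg : P.natDegree < p)
    (hP : ∀ m, P.coeff m ∈ Algebra.adjoin (ZMod p) ((↑) '' B : Set (Unitization (ZMod p) R)))
    (hg : P.eval (g : Unitization (ZMod p) R) = 0) :
    ∃ N, ∀ x ∈ augmentationIdeal (ZMod p) R ^ N, P.leadingCoeff * x = 0 := by
  have := S.nonarchimedeanAddGroup
  have hfactorial : IsUnit (P.natDegree.factorial : Unitization (ZMod p) R) := by
    simpa using ((IsUnit.natCast_factorial_iff_of_charP (A := ZMod p) p).2 hdeg).map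
      (algebraMap (ZMod p) (Unitization (ZMod p) R))
  exact exists_leadingCoeff_mul_span_range_pow_eq_zero
    (Unitization.inrNonUnitalAlgHom (ZMod p) R : R →+ Unitization (ZMod p) R) hnil hopen
    ⟨g, S.self_mem_orbitOver B g⟩ hfactorial
    fun y hy => S.eval_inr_eq_zero_of_mem_orbitOver hy hP hg

theorem transcendentalBelow_of_isOpen_orbitOver
    (hnil : ∀ x : R, IsNilpotent (x : Unitization (ZMod p) R)) (hR : ¬ IsNilpotentRing R)
    (hann : ∀ a : R, a ≠ 0 → ¬ IsNilpotentRing (AnnQuotient a)) {B : Set R} {g : R}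
    (hopen : IsOpen (S.orbitOver B g)) :
    TranscendentalBelow (Algebra.adjoin (ZMod p) ((↑) '' B : Set (Unitization (ZMod p) R))) p
      (g : Unitization (ZMod p) R) := by
  intro P hP0 hdeg hP hg
  obtain ⟨N, hN⟩ := S.exists_leadingCoeff_mul_eq_zero_of_isOpen_orbitOver hnil hopen hdeg hP hg
  exact hP0 (Polynomial.leadingCoeff_eq_zero.1
    (eq_zero_of_mul_augmentationIdeal_pow_eq_zero hnil hR hann hN))

theorem IsGeneric.not_powEqZero {S : ProfiniteRingStructure R} {g : R} (hg : S.IsGeneric g)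
    (hnil : ∀ x : R, IsNilpotent (x : Unitization (ZMod p) R)) (hR : ¬ IsNilpotentRing R)
    {j : ℕ} (hj : j < p) : ¬ PowEqZero g j := by
  intro h
  obtain ⟨N, hN⟩ := S.exists_leadingCoeff_mul_eq_zero_of_isOpen_orbitOver hnil hg
    (P := Polynomial.X ^ j) ((Polynomial.natDegree_X_pow_le j).trans_lt hj)
    (fun m => by
      rw [Polynomial.coeff_X_pow]
      split_ifs
      exacts [one_mem _, zero_mem _])
    (by rw [Polynomial.eval_X_pow, h.inr_pow_eq_zero (ZMod p)])
  simp only [Polynomial.leadingCoeff_X_pow, one_mul] at hN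
  exact hR (isNilpotentRing_of_augmentationIdeal_pow N hN)

theorem IndependentTuple.aeval_inr_ne_zero {S : ProfiniteRingStructure R} {n : ℕ} {g : Fin n → R}
    (hind : S.IndependentTuple g) (hgen : ∀ i, S.IsGeneric (g i))
    (hnil : ∀ x : R, IsNilpotent (x : Unitization (ZMod p) R)) (hR : ¬ IsNilpotentRing R)
    (hann : ∀ a : R, a ≠ 0 → ¬ IsNilpotentRing (AnnQuotient a))
    {f : MvPolynomial (Fin n) (ZMod p)} (hf : f ≠ 0) (hdeg : ∀ i, f.degreeOf i < p) :
    MvPolynomial.aeval (fun i => (g i : Unitization (ZMod p) R)) f ≠ 0 :=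
  aeval_ne_zero_of_transcendentalBelow Unitization.inl_injective
    (fun i => by
      rw [← Set.image_image ((↑) : R → Unitization (ZMod p) R) g]
      exact S.transcendentalBelow_of_isOpen_orbitOver hnil hR hann
        (hind.isOpen_orbitOver hgen i))
    hf hdeg

end NonUnitalCommRing

end ProfiniteRingStructure

theorem mainTheorem5_general {R : Type*} [NonUnitalCommRing R] [TopologicalSpace R]
    [IsTopologicalRing R] [CompactSpace R] (S : ProfiniteRingStructure R)
    {p : ℕ} (hp : p.Prime) (hchar : HasCharacteristic R p)
    (hnil : ∀ x : R, ∃ m, PowEqZero x m) (hR : ¬ IsNilpotentRing R) :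
    (∀ g : R, S.IsGeneric g → ∀ j : ℕ, j < p → ¬ PowEqZero g j) ∧
    ((∀ a : R, a ≠ 0 → ¬ IsNilpotentRing (AnnQuotient a)) →
      ∀ (n : ℕ) (f : MvPolynomial (Fin n) (ZMod p)), f ≠ 0 → (∀ i, f.degreeOf i < p) →
        ∀ g : Fin n → R, (∀ i, S.IsGeneric (g i)) → S.IndependentTuple g →
          polyValue hchar f g ≠ 0) := by
  have : Fact p.Prime := ⟨hp⟩
  let _ : Module (ZMod p) R := AddCommGroup.zmodModule hchar.1.2
  have : IsScalarTower (ZMod p) R R := ⟨fun c x y => ZMod.map_smul (AddMonoidHom.mulRight y) c x⟩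
  have : SMulCommClass (ZMod p) R R :=
    ⟨fun c x y => (ZMod.map_smul (AddMonoidHom.mulLeft x) c y).symm⟩
  have hnilpotent : ∀ x : R, IsNilpotent (x : Unitization (ZMod p) R) := fun x =>
    (hnil x).imp fun _ hm => hm.inr_pow_eq_zero (ZMod p)
  exact ⟨fun g hg j hj => hg.not_powEqZero hnilpotent hR hj,
    fun hann n f hf hdeg g hgen hind =>
      hind.aeval_inr_ne_zero hgen hnilpotent hR hann hf hdeg⟩

theorem mainTheorem5 {R : Type*} [NonUnitalCommRing R] [TopologicalSpace R]
    [IsTopologicalRing R] [CompactSpace R] [T2Space R]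
    (S : ProfiniteRingStructure R) (hsmall : S.IsSmall)
    {p : ℕ} (hp : p.Prime) (hchar : HasCharacteristic R p)
    (hnil : IsNilOfNilexponent R p) (hR : ¬ IsNilpotentRing R) :
    (∀ g : R, S.IsGeneric g → ∀ j : ℕ, 1 ≤ j → j < p → ¬ PowEqZero g j) ∧
    ((∀ a : R, a ≠ 0 → ¬ IsNilpotentRing (AnnQuotient a)) →
      ∀ (n : ℕ) (f : MvPolynomial (Fin n) (ZMod p)), f ≠ 0 → (∀ i, f.degreeOf i < p) →
        ∀ g : Fin n → R, (∀ i, S.IsGeneric (g i)) → S.IndependentTuple g →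
          polyValue hchar f g ≠ 0) :=
  (mainTheorem5_general S hp hchar (fun x => (hnil.1 x).imp fun _ hm => hm.2.1) hR).imp_left
    fun h g hg j _ => h g hg j
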